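/- Let $n=2^k$ with $k\ge 2$, and let $T_{4n}=\langle a,b\mid a^{2n}=1,\ a^n=b^2,\ b^{-1}ab=a^{-1}\rangle$ be the dicyclic group of order $4n$. For an inverse-closed subset $S\subseteq T_{4n}\setminus\{1\}$ let $\mathrm{Cay}(T_{4n},S)$ be the graph with vertex set $T_{4n}$ and edges $\{g,sg\}$, $g\in T_{4n}$, $s\in S$. For a finite simple graph with adjacency matrix $A$ put $H(t)=\exp(\mathrm{i}tA)$, $t\in\mathbb R$, and let $\mathbf e_u$ be the standard basis vector indexed by the vertex $u$. The graph admits *pretty good state transfer* (PGST) if there are distinct vertices $u,v$, a sequence $(t_j)$ of real numbers and $\gamma\in\mathbb C$ with $|\gamma|=1$ such that $\lim_{j\to\infty}H(t_j)\mathbf e_u=\gamma\,\mathbf e_v$. It admits *pretty good fractional revival* (PGFR) if there are distinct vertices $u,v$, a sequence $(t_j)$ of real numbers and $\alpha,\beta\in\mathbb C$ with $|\alpha|^2+|\beta|^2=1$ and $\beta\neq0$ such that $\lim_{j\to\infty}H(t_j)\mathbf e_u=\alpha\,\mathbf e_u+\beta\,\mathbf e_v$. Let $S=S_1\cup\langle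 a\rangle b$ with $S_1\subseteq\langle a\rangle$. Then $\mathrm{Cay}(T_{4n},S)$ admits PGST, and hence PGFR, in each of the following two cases: 1. $S_1=\{a^{k_1},a^{-k_1}\}$, where $k_1$ is odd and $1\le k_1\le n-1$; 2. $S_1=\{a^{k_1},a^{-k_1}\}\cup\bigcup_{j=1}^{r}\{a^{2^{m_j}z}: z \text{ odd},\ 1\le z\le 2^{k-m_j+1}-1\}$, where $k_1$ is odd, $1\le k_1\le n-1$, and $1\le m_1<\cdots<m_r\le k$. -/

import Mathlib

open Filter Topology
open scoped Matrix

namespace QuantumWalk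

/-- The Cayley graph `Cay(G, S)` with edges `{g, s * g}`, `g ∈ G`, `s ∈ S` (loops, which could only
come from `1 ∈ S`, are discarded). -/
def cayleyGraph {G : Type*} [Group G] (S : Set G) : SimpleGraph G :=
  SimpleGraph.fromRel fun g h => ∃ s ∈ S, s * g = h

section Transfer

variable {V : Type*} [Fintype V] [DecidableEq V]

open Classical in
/-- The transition matrix `H(t) = exp(i t A)` of a finite graph with adjacency matrix `A`. -/
noncomputable def transitionMatrix (Γ : SimpleGraph V) (t : ℝ) : Matrix V V ℂ :=
  NormedSpace.exp ((Complex.I * (t : ℂ)) • Γ.adjMatrix ℂ)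

/-- The standard basis vector `e_u`. -/
def stdVec (u : V) : V → ℂ := Pi.single u 1

/-- Pretty good state transfer from the vertex `u` to the vertex `v`. -/
def HasPGST (Γ : SimpleGraph V) (u v : V) : Prop :=
  ∃ (t : ℕ → ℝ) (γ : ℂ), ‖γ‖ = 1 ∧
    Tendsto (fun j => transitionMatrix Γ (t j) *ᵥ stdVec u) atTop (𝓝 (γ • stdVec v))

/-- (Proper) pretty good fractional revival from the vertex `u` to the vertex `v`; the degenerate
case `β = 0` (approximate periodicity) is excluded. -/
def HasPGFR (Γ : SimpleGraph V) (u v : V) : Prop :=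
  ∃ (t : ℕ → ℝ) (α β : ℂ), ‖α‖ ^ 2 + ‖β‖ ^ 2 = 1 ∧ β ≠ 0 ∧
    Tendsto (fun j => transitionMatrix Γ (t j) *ᵥ stdVec u) atTop
      (𝓝 (α • stdVec u + β • stdVec v))

/-- The graph admits pretty good state transfer between some two distinct vertices. -/
def AdmitsPGST (Γ : SimpleGraph V) : Prop := ∃ u v : V, u ≠ v ∧ HasPGST Γ u v

/-- The graph admits pretty good fractional revival between some two distinct vertices. -/
def AdmitsPGFR (Γ : SimpleGraph V) : Prop := ∃ u v : V, u ≠ v ∧ HasPGFR Γ u v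

end Transfer

/-- The generator `a` of the dicyclic group `T_{4n} = ⟨a, b | a^{2n} = 1, a^n = b^2,
b⁻¹ a b = a⁻¹⟩`, which is Mathlib's `QuaternionGroup n`. -/
def genA (n : ℕ) : QuaternionGroup n := QuaternionGroup.a 1

/-- The generator `b` of the dicyclic group `T_{4n}`. -/
def genB (n : ℕ) : QuaternionGroup n := QuaternionGroup.xa 0

/-- The coset `⟨a⟩ b` of the dicyclic group. -/
def cosetB (n : ℕ) : Set (QuaternionGroup n) :=
  {g | ∃ x ∈ Subgroup.zpowers (genA n), g = x * genB n}

end QuantumWalk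

/-! ### Kronecker's theorem via equidistribution of orbits on the torus. -/

section Kronecker

open MeasureTheory UnitAddTorus

/-! Since `S` contains the whole coset `⟨a⟩b`, the graph is the join of two copies of one circulant
graph on `ZMod (2 * n)`. A nontrivial character of `⟨a⟩`, extended by zero, sums to zero and so does
not feel the join. It is an eigenvector whose eigenvalue is its sum over `S₁`. The remaining
eigenvectors are constant on each coset, with integer eigenvalues `|S₁| ± 2n`.

The dyadic part of `S₁` is a union of differences of subgroups, so its character sums are integers.
At times `2πτ` with `τ` a natural number, integer eigenvalues contribute phase 1. Only
`2cos(2πjk₁/2n)` matters, and transfer from `1` to `a ^ n` requires its phase to tend to `(-1)^j`,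
the value at `a ^ n` of the `j`-th character.

Because a primitive `2^(k+1)`-th root of unity has degree `2^k`, the number 1 and the numbers
`2cos(2πj/2n)`, `0 < j < n/2`, are independent over the integers
(`eq_zero_of_sum_pow_sub_pow_eq_intCast`). Kronecker's theorem then prescribes their phases at will.
The symmetries of the cosine extend this to all `j`, consistently because `n` and `n/2` are even
(`exists_tendsto_exp_cycleEigenvalue`). Substituting `j * k₁` keeps the parity of `j`, as `k₁` is
odd. -/

theorem norm_orbit_average_le {d : Type*} (x : UnitAddTorus d) (f : C(UnitAddTorus d, ℂ)) (T : ℕ) :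
    ‖(T : ℂ)⁻¹ * ∑ t ∈ Finset.range T, f (t • x)‖ ≤ ‖f‖ := by
  rcases T.eq_zero_or_pos with rfl | hT
  · simp
  have hT' : (0 : ℝ) < T := by exact_mod_cast hT
  rw [norm_mul, norm_inv, Complex.norm_natCast, inv_mul_le_iff₀ hT']
  refine (norm_sum_le_of_le _ fun t _ => f.norm_coe_le_norm _).trans ?_
  simp

variable {d : Type*} [Fintype d]

theorem UnitAddTorus.mFourier_add_apply (n : d → ℤ) (x y : UnitAddTorus d) :
    mFourier n (x + y) = mFourier n x * mFourier n y := by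
  simp [mFourier, Finset.prod_mul_distrib, fourier_apply, smul_add, AddCircle.toCircle_add]

theorem UnitAddTorus.mFourier_nsmul_apply (n : d → ℤ) (x : UnitAddTorus d) (t : ℕ) :
    mFourier n (t • x) = mFourier n x ^ t := by
  induction t with
  | zero => simp [mFourier]
  | succ t ih => rw [succ_nsmul, mFourier_add_apply, ih, pow_succ]

theorem UnitAddTorus.norm_mFourier_apply (n : d → ℤ) (x : UnitAddTorus d) :
    ‖mFourier n x‖ = 1 := by
  rw [mFourier, ContinuousMap.coe_mk, norm_prod]
  exact Finset.prod_eq_one fun _ _ => Circle.norm_coe _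

theorem tendsto_geom_sum_average {z : ℂ} (hz : ‖z‖ = 1) (hz1 : z ≠ 1) :
    Tendsto (fun T : ℕ => (T : ℂ)⁻¹ * ∑ t ∈ Finset.range T, z ^ t) atTop (𝓝 0) := by
  refine squeeze_zero_norm (a := fun T : ℕ => (T : ℝ)⁻¹ * (2 / ‖z - 1‖)) (fun T => ?_) ?_
  · rw [geom_sum_eq hz1, norm_mul, norm_inv, Complex.norm_natCast, norm_div]
    gcongr
    calc ‖z ^ T - 1‖ ≤ ‖z ^ T‖ + ‖(1 : ℂ)‖ := norm_sub_le _ _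
      _ = 2 := by rw [norm_pow, hz]; norm_num
  · simpa using (tendsto_inv_atTop_nhds_zero_nat (𝕜 := ℝ)).mul_const (2 / ‖z - 1‖)

/-- Weyl's argument: nontrivial characters have geometric orbit sums with bounded numerator, and
integral zero by translation invariance. Uniform density of trigonometric polynomials does the rest,
as averages and integral are both bounded by the sup norm. -/
theorem tendsto_orbit_average (μ : Measure (UnitAddTorus d)) [μ.IsAddLeftInvariant]
    [IsProbabilityMeasure μ] (x : UnitAddTorus d)
    (hx : ∀ n : d → ℤ, n ≠ 0 → mFourier n x ≠ 1) (f : C(UnitAddTorus d, ℂ)) :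
    Tendsto (fun T : ℕ => (T : ℂ)⁻¹ * ∑ t ∈ Finset.range T, f (t • x)) atTop
      (𝓝 (∫ y, f y ∂μ)) := by
  have hint : ∀ g : C(UnitAddTorus d, ℂ), Integrable g μ := fun g =>
    g.continuous.integrable_of_hasCompactSupport (HasCompactSupport.of_compactSpace _)
  have key : ∀ g ∈ Submodule.span ℂ (Set.range (mFourier (d := d))),
      Tendsto (fun T : ℕ => (T : ℂ)⁻¹ * ∑ t ∈ Finset.range T, g (t • x)) atTop
      (𝓝 (∫ y, g y ∂μ)) := by
    intro g hg
    induction hg using Submodule.span_induction with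
    | mem g hg =>
      obtain ⟨n, rfl⟩ := hg
      by_cases hn : n = 0
      · subst hn
        simp only [mFourier_zero, ContinuousMap.one_apply]
        refine (tendsto_const_nhds (x := (1 : ℂ))).congr' ?_ |>.trans (by simp)
        filter_upwards [eventually_gt_atTop 0] with T hT
        have : (T : ℂ) ≠ 0 := by exact_mod_cast hT.ne'
        simp [this]
      · have h0 : ∫ y, mFourier n y ∂μ = 0 := by
          have h1 : ∫ y, mFourier n (x + y) ∂μ = ∫ y, mFourier n y ∂μ :=
            integral_add_left_eq_self _ x
          simp only [mFourier_add_apply, integral_const_mul] at h1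
          by_contra h
          exact hx n hn (mul_right_cancel₀ h (h1.trans (one_mul _).symm))
        rw [h0]
        simp only [mFourier_nsmul_apply]
        exact tendsto_geom_sum_average (norm_mFourier_apply n x) (hx n hn)
    | zero => simp
    | add g h _ _ ihg ihh =>
      simp only [ContinuousMap.add_apply, integral_add (hint g) (hint h), Finset.sum_add_distrib,
        mul_add]
      exact ihg.add ihh
    | smul c g _ ih =>
      simp only [ContinuousMap.smul_apply, smul_eq_mul, integral_const_mul, ← Finset.mul_sum,
        mul_left_comm _ c]
      exact ih.const_mul c
  have hf : f ∈ closure (Submodule.span ℂ (Set.range (mFourier (d := d))) : Set _) := by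
    rw [← Submodule.topologicalClosure_coe, span_mFourier_closure_eq_top]
    trivial
  rw [Metric.tendsto_atTop]
  intro ε hε
  obtain ⟨g, hg, hfg⟩ := Metric.mem_closure_iff.1 hf (ε / 3) (by positivity)
  rw [dist_eq_norm] at hfg
  obtain ⟨T₀, hT₀⟩ := Metric.tendsto_atTop.1 (key g hg) (ε / 3) (by positivity)
  refine ⟨T₀, fun T hT => ?_⟩
  have h1 := hT₀ T hT
  have h2 := norm_orbit_average_le x (f - g) T
  have h3 : ‖∫ y, (f - g) y ∂μ‖ ≤ ‖f - g‖ := by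
    simpa using norm_integral_le_of_norm_le_const (μ := μ)
      (Eventually.of_forall fun y => (f - g).norm_coe_le_norm y)
  simp only [ContinuousMap.sub_apply, integral_sub (hint f) (hint g), Finset.sum_sub_distrib,
    mul_sub] at h2 h3
  rw [dist_eq_norm] at h1 ⊢
  calc _ = ‖((T : ℂ)⁻¹ * ∑ t ∈ Finset.range T, f (t • x)
          - (T : ℂ)⁻¹ * ∑ t ∈ Finset.range T, g (t • x))
        + ((T : ℂ)⁻¹ * ∑ t ∈ Finset.range T, g (t • x) - ∫ y, g y ∂μ)
        - (∫ y, f y ∂μ - ∫ y, g y ∂μ)‖ := by congr 1; ring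
    _ ≤ _ := (norm_sub_le _ _).trans (add_le_add_left (norm_add_le _ _) _)
    _ < ε := by linarith

/-- **Kronecker's approximation theorem**: a point of the torus that is not killed by a nontrivial
character has a dense forward orbit. -/
theorem denseRange_nsmul_of_mFourier_ne_one (x : UnitAddTorus d)
    (hx : ∀ n : d → ℤ, n ≠ 0 → mFourier n x ≠ 1) : DenseRange fun t : ℕ => t • x := by
  let μ : Measure (UnitAddTorus d) := Measure.addHaarMeasure ⊤
  have : IsProbabilityMeasure μ := ⟨Measure.addHaarMeasure_self⟩
  intro y
  by_contra hy
  -- A bump function vanishing on the orbit closure has zero averages, yet positive integral because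
  -- it equals 1 at `y`.
  obtain ⟨f, hf0, hf1, hf⟩ := exists_continuous_zero_one_of_isClosed
    (isClosed_closure (s := Set.range fun t : ℕ => t • x)) (isClosed_singleton (x := y))
    (by simpa using hy)
  let g : C(UnitAddTorus d, ℂ) := ⟨fun z => (f z : ℂ), by fun_prop⟩
  have h := tendsto_orbit_average μ x hx g
  have h0 : ∀ t : ℕ, g (t • x) = 0 := fun t => by
    simpa [g] using hf0 (subset_closure ⟨t, rfl⟩)
  simp only [h0, Finset.sum_const_zero, mul_zero] at h
  have h1 : ∫ z, g z ∂μ = 0 := tendsto_nhds_unique h tendsto_const_nhds |>.symm ▸ rfl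
  have h2 : ∫ z, f z ∂μ = 0 := by
    have : ((∫ z, f z ∂μ : ℝ) : ℂ) = 0 := by rw [← h1, ← integral_complex_ofReal]; rfl
    exact_mod_cast this
  have h3 : 0 < ∫ z, f z ∂μ :=
    f.continuous.integral_pos_of_hasCompactSupport_nonneg_nonzero
      (HasCompactSupport.of_compactSpace _) (fun z => (hf z).1)
      (x := y) (by simp [hf1 (Set.mem_singleton y)])
  exact h3.ne' h2

end Kronecker

/-! ### Independence and simultaneous approximation of the cosines. -/

section Cosines

open Polynomial

theorem minpoly_natDegree_of_isPrimitiveRoot_two_pow {ζ : ℂ} {k : ℕ}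
    (hζ : IsPrimitiveRoot ζ (2 ^ (k + 1))) : (minpoly ℚ ζ).natDegree = 2 ^ k := by
  rw [← cyclotomic_eq_minpoly_rat hζ (by positivity), natDegree_cyclotomic,
    Nat.totient_prime_pow_succ Nat.prime_two]
  simp

/-- The numbers `1` and `ζ ^ j - ζ ^ (2 ^ k - j)`, `0 < j < 2 ^ (k - 1)`, are linearly independent
over the integers. -/
theorem eq_zero_of_sum_pow_sub_pow_eq_intCast {ζ : ℂ} {k : ℕ}
    (hζ : IsPrimitiveRoot ζ (2 ^ (k + 1))) {h : ℕ} (hk : 2 ^ k = 2 * h) (m : Fin (h - 1) → ℤ)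
    (c : ℤ)
    (hm : ∑ i, (m i : ℂ) * (ζ ^ (i + 1 : ℕ) - ζ ^ (2 ^ k - (i + 1) : ℕ)) = c) : m = 0 := by
  let P : ℚ[X] := ∑ i, C (m i : ℚ) * (X ^ (i + 1 : ℕ) - X ^ (2 ^ k - (i + 1) : ℕ)) - C (c : ℚ)
  have hpos : 0 < 2 ^ k := by positivity
  have hP : aeval ζ P = 0 := by
    simp [P, map_sum, hm]
  have hdeg : P.degree < (2 ^ k : ℕ) := by
    rw [← mem_degreeLT]
    have hX : ∀ j < 2 ^ k, (X ^ j : ℚ[X]) ∈ degreeLT ℚ (2 ^ k) := fun j hj => by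
      rw [mem_degreeLT, degree_X_pow]
      exact_mod_cast hj
    refine Submodule.sub_mem _ (Submodule.sum_mem _ fun i _ => ?_) ?_
    · have hi := i.2
      rw [← smul_eq_C_mul]
      exact Submodule.smul_mem _ _ (Submodule.sub_mem _ (hX _ (by omega)) (hX _ (by omega)))
    · rw [← mul_one (C _), ← smul_eq_C_mul, ← pow_zero X]
      exact Submodule.smul_mem _ _ (hX 0 hpos)
  have hP0 : P = 0 := by
    by_contra hne
    have := minpoly.degree_le_of_ne_zero ℚ ζ hne hP
    rw [degree_eq_natDegree (minpoly.ne_zero (hζ.isIntegral (by positivity)).tower_top),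
      minpoly_natDegree_of_isPrimitiveRoot_two_pow hζ] at this
    exact absurd hdeg (not_lt.2 this)
  funext i
  have hi := i.2
  have hc := congrArg (fun Q => coeff Q (i + 1 : ℕ)) hP0
  -- The reflected exponents exceed `h` while `i + 1 < h`, and `c` sits in degree 0, so the
  -- coefficient of degree `i + 1` is `m i` alone.
  have h1 : ∀ j : Fin (h - 1), ((i : ℕ) + 1 = 2 ^ k - (j + 1)) = False := fun j => by
    have := j.2
    simp only [eq_iff_iff, iff_false]
    omega
  simp only [P, coeff_sub, finsetSum_coeff, coeff_C_mul, coeff_X_pow, h1, coeff_C, if_false,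
    sub_zero, coeff_zero, Nat.add_right_cancel_iff, Fin.val_inj, mul_ite, mul_one, mul_zero,
    Finset.sum_ite_eq, Finset.mem_univ, if_true, Nat.succ_ne_zero] at hc
  exact_mod_cast hc

/-- `2 cos (2 π j / N)`, an eigenvalue of the cycle of length `N`. -/
noncomputable def cycleEigenvalue (N j : ℕ) : ℝ := 2 * Real.cos (2 * Real.pi * j / N)

/-- With `ζ ^ (2 ^ k) = -1`, the inverse of `ζ ^ j` is `-ζ ^ (2 ^ k - j)`. For `0 < j` both
exponents lie below the degree of `ζ`. -/
theorem cycleEigenvalue_eq_pow_sub_pow {k j : ℕ} (hj : j ≤ 2 ^ k) :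
    (cycleEigenvalue (2 ^ (k + 1)) j : ℂ) =
      Complex.exp (2 * Real.pi * Complex.I / (2 ^ (k + 1) : ℕ)) ^ j
        - Complex.exp (2 * Real.pi * Complex.I / (2 ^ (k + 1) : ℕ)) ^ (2 ^ k - j) := by
  rw [← Complex.exp_nat_mul, ← Complex.exp_nat_mul, Nat.cast_sub hj, cycleEigenvalue]
  push_cast
  rw [Complex.cos]
  have h : ((2 : ℂ) ^ k - j) * (2 * Real.pi * Complex.I / 2 ^ (k + 1))
      = -(2 * Real.pi * j / 2 ^ (k + 1)) * Complex.I + Real.pi * Complex.I := by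
    field_simp
    ring
  rw [h, Complex.exp_add_pi_mul_I]
  ring_nf

theorem cycleEigenvalue_mod (N j : ℕ) : cycleEigenvalue N (j % N) = cycleEigenvalue N j := by
  rcases N.eq_zero_or_pos with rfl | hN
  · simp
  have hN' : (N : ℝ) ≠ 0 := by exact_mod_cast hN.ne'
  have h : 2 * Real.pi * j / N = 2 * Real.pi * (j % N : ℕ) / N + (j / N : ℕ) * (2 * Real.pi) := by
    have : (j : ℝ) = N * (j / N : ℕ) + (j % N : ℕ) := by exact_mod_cast (Nat.div_add_mod j N).symm
    rw [this]
    field_simp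
    ring_nf
  rw [cycleEigenvalue, cycleEigenvalue, h, Real.cos_add_nat_mul_two_pi]

theorem cycleEigenvalue_sub {N j : ℕ} (hN : 0 < N) (hj : j ≤ N) :
    cycleEigenvalue N (N - j) = cycleEigenvalue N j := by
  have hN' : (N : ℝ) ≠ 0 := by exact_mod_cast hN.ne'
  have h : 2 * Real.pi * (N - j : ℕ) / N = 2 * Real.pi - 2 * Real.pi * j / N := by
    rw [Nat.cast_sub hj]
    field_simp
  rw [cycleEigenvalue, cycleEigenvalue, h, Real.cos_two_pi_sub]

theorem cycleEigenvalue_two_mul_sub {n j : ℕ} (hn : 0 < n) (hj : j ≤ n) :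
    cycleEigenvalue (2 * n) (n - j) = -cycleEigenvalue (2 * n) j := by
  have hn' : (n : ℝ) ≠ 0 := by exact_mod_cast hn.ne'
  have h : 2 * Real.pi * (n - j : ℕ) / (2 * n : ℕ)
      = Real.pi - 2 * Real.pi * j / (2 * n : ℕ) := by
    rw [Nat.cast_sub hj]
    push_cast
    field_simp
  rw [cycleEigenvalue, cycleEigenvalue, h, Real.cos_pi_sub, mul_neg]

theorem mFourier_coe_apply {d : Type*} [Fintype d] (n : d → ℤ) (x : d → ℝ) :
    UnitAddTorus.mFourier n (fun i => (x i : UnitAddCircle))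
      = Complex.exp (2 * Real.pi * Complex.I * ∑ i, (n i : ℂ) * x i) := by
  simp only [UnitAddTorus.mFourier, ContinuousMap.coe_mk, fourier_coe_apply, Finset.mul_sum,
    Complex.exp_sum]
  refine Finset.prod_congr rfl fun i _ => ?_
  congr 1
  push_cast
  ring

/-- Simultaneous approximation of the eigenvalues of the cycle of length `2 ^ (k + 1)`. -/
theorem exists_tendsto_exp_cycleEigenvalue {k : ℕ} (hk : 2 ≤ k) :
    ∃ τ : ℕ → ℕ, ∀ j : ℕ, Tendsto (fun l => Complex.exp
      (2 * Real.pi * Complex.I * (τ l * cycleEigenvalue (2 * 2 ^ k) j))) atTop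
      (𝓝 ((-1) ^ j)) := by
  obtain ⟨q, rfl⟩ := Nat.exists_eq_add_of_le' hk
  set n := 2 ^ (q + 2) with hn
  set h := 2 ^ (q + 1) with hh
  have hnh : n = 2 * h := by rw [hn, hh]; ring
  have hheven : Even h := ⟨2 ^ q, by rw [hh]; ring⟩
  have hhpos : 0 < h := by positivity
  have hN : 2 * n = 2 ^ (q + 2 + 1) := by rw [hn]; ring
  let θ : ℕ → ℝ := cycleEigenvalue (2 * n)
  let x : Fin (h - 1) → ℝ := fun i => θ (i + 1)
  have hdense := denseRange_nsmul_of_mFourier_ne_one (fun i => (x i : UnitAddCircle)) (by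
    intro m hm hone
    rw [mFourier_coe_apply, Complex.exp_eq_one_iff] at hone
    obtain ⟨c, hc⟩ := hone
    refine hm (eq_zero_of_sum_pow_sub_pow_eq_intCast
      (Complex.isPrimitiveRoot_exp (2 ^ (q + 2 + 1)) (by positivity)) hnh m c ?_)
    rw [mul_comm (c : ℂ)] at hc
    rw [← mul_left_cancel₀ Complex.two_pi_I_ne_zero hc]
    refine Finset.sum_congr rfl fun i _ => ?_
    have hi := i.2
    rw [← cycleEigenvalue_eq_pow_sub_pow (by omega), ← hN])
  -- The target coordinate `(i + 1) / 2` modulo 1 encodes the phase `(-1) ^ (i + 1)`.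
  obtain ⟨u, hu, hlim⟩ := mem_closure_iff_seq_limit.1
    (hdense fun i => (((i + 1 : ℕ) / 2 : ℝ) : UnitAddCircle))
  choose τ hτ using hu
  have base : ∀ j : ℕ, 0 < j → j < h → Tendsto (fun l => Complex.exp
      (2 * Real.pi * Complex.I * (τ l * θ j))) atTop (𝓝 ((-1) ^ j)) := by
    intro j hj0 hj
    obtain ⟨i, rfl⟩ := Nat.exists_eq_succ_of_ne_zero hj0.ne'
    have h1 := (tendsto_pi_nhds.1 hlim) ⟨i, by omega⟩
    have h2 := ((fourier 1 : C(UnitAddCircle, ℂ)).continuous.tendsto _).comp h1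
    convert h2 using 2
    · rename_i l
      rw [Function.comp_apply, ← hτ l]
      change _ = fourier 1 (τ l • (x _ : UnitAddCircle))
      rw [← AddCircle.coe_nsmul, fourier_coe_apply]
      simp [x]
    · rw [fourier_coe_apply, ← Complex.exp_pi_mul_I, ← Complex.exp_nat_mul]
      congr 1
      push_cast
      field_simp
  have hn2 : ∀ j ≤ n, θ (n - j) = -θ j := fun j hj => cycleEigenvalue_two_mul_sub (by omega) hj
  have half : ∀ j : ℕ, j < h → Tendsto (fun l => Complex.exp
      (2 * Real.pi * Complex.I * (τ l * θ j))) atTop (𝓝 ((-1) ^ j)) := by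
    intro j hj
    rcases j.eq_zero_or_pos with rfl | hj0
    -- The eigenvalue at `j = 0` is the integer 2, so its phase is exactly 1.
    · refine tendsto_const_nhds.congr fun l => ?_
      rw [pow_zero, eq_comm, Complex.exp_eq_one_iff]
      refine ⟨2 * τ l, ?_⟩
      simp [θ, cycleEigenvalue]
      ring
    · exact base j hj0 hj
  have upto : ∀ j : ℕ, j ≤ n → Tendsto (fun l => Complex.exp
      (2 * Real.pi * Complex.I * (τ l * θ j))) atTop (𝓝 ((-1) ^ j)) := by
    intro j hj
    rcases lt_trichotomy j h with hlt | rfl | hgt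
    · exact half j hlt
    · have h0 : θ h = 0 := by
        have := hn2 h hj
        rw [show n - h = h by omega] at this
        linarith
      simp [h0, hheven.neg_one_pow]
    -- Reflection `j ↦ n - j` negates the eigenvalue and inverts the phase; parity is kept because
    -- `n` is even.
    · have h1 := (half (n - j) (by omega)).inv₀ (pow_ne_zero _ (by norm_num))
      have hpar : ((-1 : ℂ) ^ (n - j))⁻¹ = (-1) ^ j := by
        have : (-1 : ℂ) ^ (n - j) * (-1) ^ j = 1 := by
          rw [← pow_add, Nat.sub_add_cancel hj]
          exact Even.neg_one_pow (by rw [hnh]; exact even_two_mul h)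
        exact inv_eq_of_mul_eq_one_right this
      rw [hpar] at h1
      refine h1.congr fun l => ?_
      rw [← Complex.exp_neg, hn2 j hj]
      congr 1
      push_cast
      ring
  refine ⟨τ, fun j => ?_⟩
  have hlt : j % (2 * n) < 2 * n := Nat.mod_lt _ (by omega)
  have hpar : (-1 : ℂ) ^ (j % (2 * n)) = (-1) ^ j := by
    conv_rhs => rw [← Nat.div_add_mod j (2 * n), pow_add, mul_assoc, pow_mul]
    simp
  rw [← cycleEigenvalue_mod, ← hpar]
  rcases le_or_gt (j % (2 * n)) n with hle | hgt
  · exact upto _ hle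
  · rw [← cycleEigenvalue_sub (by omega) hlt.le]
    convert upto (2 * n - j % (2 * n)) (by omega) using 2
    have : (-1 : ℂ) ^ (2 * n - j % (2 * n)) * (-1) ^ (j % (2 * n)) = 1 := by
      rw [← pow_add, Nat.sub_add_cancel hlt.le]
      exact Even.neg_one_pow (even_two_mul n)
    rcases neg_one_pow_eq_or ℂ (j % (2 * n)) with h | h <;> rw [h] at this ⊢
    · linear_combination -this
    · linear_combination this

end Cosines

/-! ### The transition matrix on eigenvectors. -/

section Exponential

variable {V : Type*} [Fintype V] [DecidableEq V]

open scoped Matrix.Norms.Operator in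
theorem Matrix.exp_mulVec_of_mulVec_eq_smul {M : Matrix V V ℂ} {v : V → ℂ} {μ : ℂ}
    (h : M *ᵥ v = μ • v) : NormedSpace.exp M *ᵥ v = Complex.exp μ • v := by
  have hpow : ∀ m : ℕ, M ^ m *ᵥ v = μ ^ m • v := fun m => by
    induction m with
    | zero => simp
    | succ m ih => rw [pow_succ, ← Matrix.mulVec_mulVec, h, Matrix.mulVec_smul, ih, smul_smul,
        pow_succ']
  have h1 := (NormedSpace.exp_series_hasSum_exp' (𝕂 := ℂ) M).map
    (⟨⟨fun A => A *ᵥ v, Matrix.zero_mulVec v⟩, fun A B => Matrix.add_mulVec A B v⟩ :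
      Matrix V V ℂ →+ (V → ℂ)) (by
        change Continuous fun A : Matrix V V ℂ => A *ᵥ v
        fun_prop)
  have h2 := (NormedSpace.exp_series_hasSum_exp' (𝕂 := ℂ) μ).smul_const v
  rw [← Complex.exp_eq_exp_ℂ] at h2
  refine h1.unique (h2.congr_fun fun m => ?_)
  simp [Matrix.smul_mulVec, hpow, smul_smul]

end Exponential

namespace QuantumWalk

theorem transitionMatrix_mulVec_of_eigenvector {V : Type*} [Fintype V] [DecidableEq V]
    {Γ : SimpleGraph V} {v : V → ℂ} {μ : ℂ}
    (h : ∀ i, (∑ j, (open Classical in if Γ.Adj i j then v j else 0)) = μ * v i) (t : ℝ) :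
    transitionMatrix Γ t *ᵥ v = Complex.exp (Complex.I * t * μ) • v := by
  classical
  refine Matrix.exp_mulVec_of_mulVec_eq_smul ?_
  rw [Matrix.smul_mulVec, ← smul_smul (Complex.I * (t : ℂ)) μ v]
  refine congrArg _ (funext fun i => ?_)
  rw [Pi.smul_apply, smul_eq_mul, ← h i]
  simp only [Matrix.mulVec, dotProduct, SimpleGraph.adjMatrix_apply, ite_mul, one_mul, zero_mul]

theorem HasPGST.hasPGFR {V : Type*} [Fintype V] [DecidableEq V] {Γ : SimpleGraph V} {u v : V}
    (h : HasPGST Γ u v) : HasPGFR Γ u v := by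
  obtain ⟨t, γ, hγ, ht⟩ := h
  refine ⟨t, 0, γ, by simp [hγ], ?_, by simpa using ht⟩
  rintro rfl
  simp at hγ

/-! ### Spectral decomposition of the join of two circulants. -/

section Join

open QuaternionGroup

variable {n : ℕ}

theorem sum_quaternionGroup [NeZero n] {M : Type*} [AddCommMonoid M] (f : QuaternionGroup n → M) :
    ∑ g, f g = ∑ i, f (a i) + ∑ i, f (xa i) := by
  let e : ZMod (2 * n) ⊕ ZMod (2 * n) ≃ QuaternionGroup n :=
    { toFun := Sum.elim a xa
      invFun := fun g => match g with
        | a j => Sum.inl j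
        | xa j => Sum.inr j
      left_inv := by rintro (x | x) <;> rfl
      right_inv := by rintro (x | x) <;> rfl }
  rw [← e.sum_comp, Fintype.sum_sum_type]
  rfl

/-- A function on the dicyclic group, given by its values on the two cosets of `⟨a⟩`. -/
def cosetFun (f g : ZMod (2 * n) → ℂ) : QuaternionGroup n → ℂ
  | a i => f i
  | xa i => g i

@[simp] theorem cosetFun_a (f g : ZMod (2 * n) → ℂ) (i : ZMod (2 * n)) :
    cosetFun f g (a i) = f i := rfl

@[simp] theorem cosetFun_xa (f g : ZMod (2 * n) → ℂ) (i : ZMod (2 * n)) :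
    cosetFun f g (xa i) = g i := rfl

/-- `Γ` is the join of two copies, on the two cosets of `⟨a⟩`, of the circulant graph with
connection set `T`. -/
structure IsCirculantJoin (Γ : SimpleGraph (QuaternionGroup n)) (T : Finset (ZMod (2 * n))) :
    Prop where
  adj_a_a : ∀ i j, Γ.Adj (a i) (a j) ↔ j - i ∈ T
  adj_xa_xa : ∀ i j, Γ.Adj (xa i) (xa j) ↔ j - i ∈ T
  adj_a_xa : ∀ i j, Γ.Adj (a i) (xa j)

variable {Γ : SimpleGraph (QuaternionGroup n)} {T : Finset (ZMod (2 * n))}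

/-- Left multiplication by `a s` sends `xa i` to `xa (i - s)`, so closure under negation is what
gives both cosets the same connection set. -/
theorem isCirculantJoin_cayleyGraph {S : Set (QuaternionGroup n)}
    (hS : S = {g | ∃ s ∈ T, g = a s} ∪ {g | ∃ s, g = xa s}) (h0 : 0 ∉ T)
    (hneg : ∀ s ∈ T, -s ∈ T) : IsCirculantJoin (cayleyGraph S) T := by
  have hneg' : ∀ i j : ZMod (2 * n), i - j ∈ T → j - i ∈ T := fun i j h => by
    simpa using hneg _ h
  have ha : ∀ s, a s ∈ S ↔ s ∈ T := fun s => by simp [hS]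
  have hx : ∀ s, xa s ∈ S := fun s => by simp [hS]
  have h1 : ∀ i j : ZMod (2 * n), (∃ s ∈ S, s * a i = a j) ↔ j - i ∈ T := by
    refine fun i j => ⟨?_, fun h => ⟨a (j - i), (ha _).2 h, by simp⟩⟩
    rintro ⟨s | s, hs, h⟩
    · rw [a_mul_a, a.injEq] at h
      rw [← h]
      simpa using (ha s).1 hs
    · simp at h
  have h2 : ∀ i j : ZMod (2 * n), (∃ s ∈ S, s * xa i = xa j) ↔ j - i ∈ T := by
    refine fun i j => ⟨?_, fun h => ⟨a (i - j), (ha _).2 (hneg' _ _ h), by simp⟩⟩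
    rintro ⟨s | s, hs, h⟩
    · rw [a_mul_xa, xa.injEq] at h
      rw [← h]
      simpa using hneg s ((ha s).1 hs)
    · simp at h
  refine ⟨fun i j => ?_, fun i j => ?_, fun i j => ?_⟩
  · rw [cayleyGraph, SimpleGraph.fromRel_adj, h1, h1]
    refine ⟨fun h => h.2.elim id (hneg' _ _), fun h => ⟨?_, Or.inl h⟩⟩
    rintro h'
    rw [a.inj h', sub_self] at h
    exact h0 h
  · rw [cayleyGraph, SimpleGraph.fromRel_adj, h2, h2]
    refine ⟨fun h => h.2.elim id (hneg' _ _), fun h => ⟨?_, Or.inl h⟩⟩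
    rintro h'
    rw [xa.inj h', sub_self] at h
    exact h0 h
  · rw [cayleyGraph, SimpleGraph.fromRel_adj]
    exact ⟨by simp, Or.inl ⟨xa (j - i), hx _, by simp⟩⟩

variable [NeZero n]

theorem sum_ite_sub_mem (f : ZMod (2 * n) → ℂ) (i : ZMod (2 * n)) :
    ∑ j, (if j - i ∈ T then f j else 0) = ∑ s ∈ T, f (i + s) := by
  rw [← Equiv.sum_comp (Equiv.addLeft i)]
  simp

open Classical in
theorem IsCirculantJoin.sum_adj_a (h : IsCirculantJoin Γ T) (f g : ZMod (2 * n) → ℂ)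
    (i : ZMod (2 * n)) :
    ∑ x, (if Γ.Adj (a i) x then cosetFun f g x else 0) = ∑ s ∈ T, f (i + s) + ∑ j, g j := by
  rw [sum_quaternionGroup, ← sum_ite_sub_mem]
  simp [h.adj_a_a, h.adj_a_xa]

open Classical in
theorem IsCirculantJoin.sum_adj_xa (h : IsCirculantJoin Γ T) (f g : ZMod (2 * n) → ℂ)
    (i : ZMod (2 * n)) :
    ∑ x, (if Γ.Adj (xa i) x then cosetFun f g x else 0) = ∑ j, f j + ∑ s ∈ T, g (i + s) := by
  rw [sum_quaternionGroup, ← sum_ite_sub_mem]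
  simp [h.adj_xa_xa, (h.adj_a_xa _ _).symm]

/-- The character `i ↦ χ (j i)` on `⟨a⟩`, extended by zero. -/
noncomputable def charFun (j : ZMod (2 * n)) : QuaternionGroup n → ℂ :=
  cosetFun (fun i => ZMod.stdAddChar (j * i)) 0

theorem IsCirculantJoin.transitionMatrix_charFun (h : IsCirculantJoin Γ T) {j : ZMod (2 * n)}
    (hj : j ≠ 0) (t : ℝ) :
    transitionMatrix Γ t *ᵥ charFun j =
      Complex.exp (Complex.I * t * ∑ s ∈ T, ZMod.stdAddChar (j * s)) • charFun j := by
  refine transitionMatrix_mulVec_of_eigenvector ?_ t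
  rintro (i | i)
  · rw [charFun, h.sum_adj_a]
    simp [mul_add, AddChar.map_add_eq_mul, Finset.mul_sum, mul_comm]
  · rw [charFun, h.sum_adj_xa]
    have := AddChar.sum_mulShift j (ZMod.isPrimitive_stdAddChar (2 * n))
    simp only [hj, if_false, mul_comm _ j] at this
    simpa using this

theorem IsCirculantJoin.transitionMatrix_const (h : IsCirculantJoin Γ T) {ε : ℂ} (hε : ε ^ 2 = 1)
    (t : ℝ) :
    transitionMatrix Γ t *ᵥ cosetFun (fun _ => 1) (fun _ => ε) =
      Complex.exp (Complex.I * t * (T.card + ε * (2 * n : ℕ))) •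
        cosetFun (fun _ => 1) (fun _ => ε) := by
  refine transitionMatrix_mulVec_of_eigenvector ?_ t
  rintro (i | i)
  · rw [h.sum_adj_a]
    simp
    ring
  · rw [h.sum_adj_xa]
    simp
    linear_combination (-2 * n : ℂ) * hε

/-- Fourier inversion on `⟨a⟩`. The trivial character supported on one coset is not an eigenvector,
so it is split as half the sum of the two vectors constant on cosets. -/
theorem stdVec_a_eq (c : ZMod (2 * n)) :
    stdVec (a c) = ((2 * n : ℕ) : ℂ)⁻¹ • (∑ j ∈ Finset.univ.erase 0,
        ZMod.stdAddChar (-(j * c)) • charFun j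
      + ((1 / 2 : ℂ) • cosetFun (fun _ => 1) (fun _ => 1)
        + (1 / 2 : ℂ) • cosetFun (fun _ => 1) (fun _ => -1))) := by
  have hN : ((2 * n : ℕ) : ℂ) ≠ 0 := Nat.cast_ne_zero.2 (NeZero.ne _)
  funext x
  rcases x with i | i
  · have h1 := AddChar.sum_mulShift (i - c) (ZMod.isPrimitive_stdAddChar (2 * n))
    rw [← Finset.add_sum_erase _ _ (Finset.mem_univ 0)] at h1
    have h2 : (stdVec (a c) : QuaternionGroup n → ℂ) (a i) = if i - c = 0 then 1 else 0 := by
      simp [stdVec, Pi.single_apply, sub_eq_zero]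
    have h3 : ∑ j ∈ Finset.univ.erase (0 : ZMod (2 * n)),
        (ZMod.stdAddChar (-(j * c)) : ℂ) * ZMod.stdAddChar (j * i)
        = ∑ j ∈ Finset.univ.erase (0 : ZMod (2 * n)), ZMod.stdAddChar (j * (i - c)) := by
      refine Finset.sum_congr rfl fun j _ => ?_
      rw [← AddChar.map_add_eq_mul]
      congr 1
      ring
    rw [h2]
    simp only [Pi.smul_apply, Pi.add_apply, Finset.sum_apply, smul_eq_mul, charFun, cosetFun_a, h3]
    rw [eq_inv_mul_iff_mul_eq₀ hN]
    simp only [zero_mul, AddChar.map_zero_eq_one, ZMod.card] at h1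
    split_ifs at h1 ⊢ <;> linear_combination -h1
  · simp [stdVec, charFun]

/-- A circulant join has pretty good state transfer from `a ^ 0` to `a ^ n` as soon as the phases
of its eigenvalues approximate a character. -/
theorem IsCirculantJoin.hasPGST (h : IsCirculantJoin Γ T) (t : ℕ → ℝ)
    (hchar : ∀ j : ZMod (2 * n), j ≠ 0 → Tendsto (fun l => Complex.exp
      (Complex.I * t l * ∑ s ∈ T, ZMod.stdAddChar (j * s))) atTop
      (𝓝 (ZMod.stdAddChar (-(j * (n : ZMod (2 * n)))))))
    (hconst : ∀ ε : ℂ, ε = 1 ∨ ε = -1 → Tendsto (fun l => Complex.exp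
      (Complex.I * t l * (T.card + ε * (2 * n : ℕ)))) atTop (𝓝 1)) :
    HasPGST Γ (a 0) (a n) := by
  refine ⟨t, 1, by simp, ?_⟩
  rw [one_smul, stdVec_a_eq (n : ZMod (2 * n)), stdVec_a_eq 0]
  have hlim : Tendsto (fun l => ((2 * n : ℕ) : ℂ)⁻¹ • (∑ j ∈ Finset.univ.erase (0 : ZMod (2 * n)),
        Complex.exp (Complex.I * t l * ∑ s ∈ T, ZMod.stdAddChar (j * s)) • charFun j
      + ((1 / 2 : ℂ) • Complex.exp (Complex.I * t l * (T.card + 1 * (2 * n : ℕ))) •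
          cosetFun (fun _ => 1) (fun _ => 1)
        + (1 / 2 : ℂ) • Complex.exp (Complex.I * t l * (T.card + -1 * (2 * n : ℕ))) •
          cosetFun (fun _ => 1) (fun _ => -1)))) atTop (𝓝 (((2 * n : ℕ) : ℂ)⁻¹ •
      (∑ j ∈ Finset.univ.erase (0 : ZMod (2 * n)),
        ZMod.stdAddChar (-(j * (n : ZMod (2 * n)))) • charFun j
      + ((1 / 2 : ℂ) • (1 : ℂ) • cosetFun (fun _ => 1) (fun _ => 1)
        + (1 / 2 : ℂ) • (1 : ℂ) • cosetFun (fun _ => 1) (fun _ => -1))))) :=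
    ((tendsto_finsetSum _ fun j hj =>
        (hchar j (Finset.ne_of_mem_erase hj)).smul_const _).add
      ((((hconst 1 (Or.inl rfl)).smul_const _).const_smul _).add
        (((hconst (-1) (Or.inr rfl)).smul_const _).const_smul _))).const_smul _
  simp only [one_smul] at hlim
  refine hlim.congr fun l => ?_
  rw [Matrix.mulVec_smul, Matrix.mulVec_add, Matrix.mulVec_add, Matrix.mulVec_smul,
    Matrix.mulVec_smul, h.transitionMatrix_const (one_pow 2), h.transitionMatrix_const (by norm_num),
    Matrix.mulVec_sum]
  congr 2
  refine Finset.sum_congr rfl fun j hj => ?_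
  rw [mul_zero, neg_zero, AddChar.map_zero_eq_one, one_smul,
    h.transitionMatrix_charFun (Finset.ne_of_mem_erase hj)]

end Join

end QuantumWalk

namespace QuantumWalk

/-! ### Integrality of character sums over dyadic levels. -/

section CharacterSums

/-- By orthogonality the sum is the order of `H` or zero. -/
theorem exists_int_eq_sum_addSubgroup {A : Type*} [AddCommGroup A] [Fintype A] [DecidableEq A]
    (H : AddSubgroup A) [DecidablePred (· ∈ H)] (ψ : AddChar A ℂ) :
    ∃ c : ℤ, ∑ s with s ∈ H, ψ s = c := by
  classical
  have h := AddChar.sum_eq_ite (ψ.compAddMonoidHom H.subtype)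
  have h1 : ∑ s with s ∈ H, ψ s = ∑ s : H, ψ.compAddMonoidHom H.subtype s :=
    Finset.sum_subtype _ (by simp) _
  rw [h1, h]
  split_ifs
  · exact ⟨Fintype.card H, by simp⟩
  · exact ⟨0, by simp⟩

theorem zmod_natCast_dvd_natCast_iff {N d z : ℕ} (hd : d ∣ N) :
    (d : ZMod N) ∣ (z : ZMod N) ↔ d ∣ z := by
  refine ⟨fun h => ?_, Nat.cast_dvd_cast⟩
  have := map_dvd (ZMod.castHom hd (ZMod d)) h
  simpa [ZMod.natCast_eq_zero_iff] using this

/-- The residues modulo `N` that are divisible by `2 ^ m` but not by `2 ^ (m + 1)`. -/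
def dyadicLevel (N : ℕ) [NeZero N] (m : ℕ) : Finset (ZMod N) :=
  open Classical in {s | ((2 ^ m : ℕ) : ZMod N) ∣ s ∧ ¬ ((2 ^ (m + 1) : ℕ) : ZMod N) ∣ s}

variable {N : ℕ} [NeZero N]

theorem mem_dyadicLevel {m : ℕ} {s : ZMod N} : s ∈ dyadicLevel N m ↔
    ((2 ^ m : ℕ) : ZMod N) ∣ s ∧ ¬ ((2 ^ (m + 1) : ℕ) : ZMod N) ∣ s := by
  simp [dyadicLevel]

/-- A level is the subgroup of multiples of `2 ^ m` minus that of multiples of `2 ^ (m + 1)`. -/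
theorem exists_int_eq_sum_dyadicLevel (m : ℕ) (ψ : AddChar (ZMod N) ℂ) :
    ∃ c : ℤ, ∑ s ∈ dyadicLevel N m, ψ s = c := by
  classical
  let H : ℕ → AddSubgroup (ZMod N) := fun m => (Ideal.span {((2 ^ m : ℕ) : ZMod N)}).toAddSubgroup
  have hH : ∀ m s, s ∈ H m ↔ ((2 ^ m : ℕ) : ZMod N) ∣ s := fun m s =>
    Ideal.mem_span_singleton
  obtain ⟨c, hc⟩ := exists_int_eq_sum_addSubgroup (H m) ψ
  obtain ⟨c', hc'⟩ := exists_int_eq_sum_addSubgroup (H (m + 1)) ψ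
  refine ⟨c - c', ?_⟩
  have hsub : ({s | s ∈ H (m + 1)} : Finset (ZMod N)) ⊆
      ({s | s ∈ H m} : Finset (ZMod N)) := by
    intro s
    simp only [Finset.mem_filter, Finset.mem_univ, true_and, hH]
    exact (Nat.cast_dvd_cast (pow_dvd_pow 2 m.le_succ)).trans
  have hset : dyadicLevel N m
      = ({s | s ∈ H m} : Finset (ZMod N)) \ ({s | s ∈ H (m + 1)} : Finset (ZMod N)) := by
    ext s
    simp [mem_dyadicLevel, hH]
  rw [hset, Int.cast_sub, ← hc, ← hc', eq_sub_iff_add_eq, Finset.sum_sdiff hsub]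

theorem disjoint_dyadicLevel {m m' : ℕ} (h : m ≠ m') :
    Disjoint (dyadicLevel N m) (dyadicLevel N m') := by
  wlog hlt : m < m' generalizing m m'
  · exact (this h.symm (by omega)).symm
  rw [Finset.disjoint_left]
  intro s hs hs'
  rw [mem_dyadicLevel] at hs hs'
  exact hs.2 ((Nat.cast_dvd_cast (pow_dvd_pow 2 hlt)).trans hs'.1)

theorem neg_mem_dyadicLevel {m : ℕ} {s : ZMod N} (hs : s ∈ dyadicLevel N m) :
    -s ∈ dyadicLevel N m := by
  simpa [mem_dyadicLevel] using hs

theorem mem_dyadicLevel_two_pow_iff {k m : ℕ} (hm : m ≤ k) {s : ZMod (2 * 2 ^ k)} :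
    s ∈ dyadicLevel (2 * 2 ^ k) m ↔ ∃ z : ℕ, Nat.gcd z 2 = 1 ∧ 1 ≤ z ∧ z ≤ 2 ^ (k - m + 1) - 1 ∧
      s = ((2 ^ m * z : ℕ) : ZMod (2 * 2 ^ k)) := by
  have hN : 2 * 2 ^ k = 2 ^ (k + 1) := by ring
  have hdvd : ∀ i ≤ k + 1, 2 ^ i ∣ 2 * 2 ^ k := fun i hi => hN ▸ pow_dvd_pow 2 hi
  have hodd : ∀ z, Nat.gcd z 2 = 1 ↔ ¬ 2 ∣ z := fun z => by
    rw [Nat.gcd_comm]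
    exact Nat.prime_two.coprime_iff_not_dvd
  have hlevel : ∀ z : ℕ, ((2 ^ m * z : ℕ) : ZMod (2 * 2 ^ k)) ∈ dyadicLevel (2 * 2 ^ k) m ↔
      ¬ 2 ∣ z := fun z => by
    rw [mem_dyadicLevel, zmod_natCast_dvd_natCast_iff (hdvd _ (by omega)),
      zmod_natCast_dvd_natCast_iff (hdvd _ (by omega)), pow_succ,
      Nat.mul_dvd_mul_iff_left (by positivity)]
    simp
  constructor
  · intro hs
    have hval : ((s.val : ℕ) : ZMod (2 * 2 ^ k)) = s := ZMod.natCast_zmod_val s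
    have h1 := (mem_dyadicLevel.1 hs).1
    rw [← hval, zmod_natCast_dvd_natCast_iff (hdvd _ (by omega))] at h1
    obtain ⟨z, hz⟩ := h1
    rw [← hval, hz, hlevel] at hs
    refine ⟨z, (hodd z).2 hs, ?_, ?_, by rw [← hz, hval]⟩
    · rcases z.eq_zero_or_pos with rfl | h
      · simp at hs
      · exact h
    · refine Nat.le_sub_one_of_lt ?_
      have := s.val_lt
      rw [hz, show 2 * 2 ^ k = 2 ^ m * 2 ^ (k - m + 1) by
        rw [hN, ← pow_add]; congr 1; omega] at this
      exact Nat.lt_of_mul_lt_mul_left this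
  · rintro ⟨z, hz, -, -, rfl⟩
    exact (hlevel z).2 ((hodd z).1 hz)

end CharacterSums

/-! ### State transfer on the dicyclic Cayley graphs. -/

section Transfer

open QuaternionGroup

theorem genA_zpow (n : ℕ) (i : ℤ) : genA n ^ i = a i := by
  cases i with
  | ofNat i => simp [genA]
  | negSucc i =>
    rw [zpow_negSucc, genA, a_one_pow, Int.cast_negSucc]
    rfl

theorem cosetB_eq (n : ℕ) : cosetB n = {g | ∃ s, g = xa s} := by
  ext g
  constructor
  · rintro ⟨x, hx, rfl⟩
    obtain ⟨i, rfl⟩ := Subgroup.mem_zpowers_iff.1 hx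
    exact ⟨-i, by simp [genA_zpow, genB]⟩
  · rintro ⟨s, rfl⟩
    obtain ⟨i, rfl⟩ := ZMod.intCast_surjective s
    exact ⟨genA n ^ (-i), Subgroup.zpow_mem_zpowers _ _, by simp [genA_zpow, genB, -zpow_neg]⟩

theorem stdAddChar_add_neg {N : ℕ} [NeZero N] (J : ℕ) :
    (ZMod.stdAddChar (J : ZMod N) : ℂ) + ZMod.stdAddChar (-(J : ZMod N)) = cycleEigenvalue N J := by
  have h1 := ZMod.stdAddChar_coe (N := N) J
  have h2 := ZMod.stdAddChar_coe (N := N) (-J)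
  push_cast at h1 h2
  rw [h1, h2, cycleEigenvalue]
  push_cast
  rw [Complex.two_cos]
  congr 2 <;> ring

theorem stdAddChar_neg_natCast_mul {n : ℕ} [NeZero n] (J : ℕ) :
    (ZMod.stdAddChar (-((J : ZMod (2 * n)) * (n : ZMod (2 * n)))) : ℂ) = (-1) ^ J := by
  have hn : (n : ℂ) ≠ 0 := Nat.cast_ne_zero.2 (NeZero.ne n)
  have h1 := ZMod.stdAddChar_coe (N := 2 * n) (-(J * n))
  push_cast at h1
  rw [h1, show 2 * (Real.pi : ℂ) * Complex.I * -(J * n) / (2 * n)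
    = -(J * (Real.pi * Complex.I)) by field_simp, Complex.exp_neg, Complex.exp_nat_mul,
    Complex.exp_pi_mul_I, ← inv_pow]
  norm_num

/-- Pretty good state transfer on a circulant join whose connection set consists of a pair of odd
residues and a part with integral character sums. -/
theorem IsCirculantJoin.exists_hasPGST {k : ℕ} (hk : 2 ≤ k)
    {Γ : SimpleGraph (QuaternionGroup (2 ^ k))} {T U : Finset (ZMod (2 * 2 ^ k))}
    (h : IsCirculantJoin Γ T) {k₁ : ℕ} (hk₁ : Odd k₁)
    (hsum : ∀ ψ : AddChar (ZMod (2 * 2 ^ k)) ℂ,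
      ∑ s ∈ T, ψ s = ψ k₁ + ψ (-k₁) + ∑ s ∈ U, ψ s)
    (hint : ∀ ψ : AddChar (ZMod (2 * 2 ^ k)) ℂ, ∃ c : ℤ, ∑ s ∈ U, ψ s = c) :
    HasPGST Γ (a 0) (a (2 ^ k : ℕ)) := by
  obtain ⟨τ, hτ⟩ := exists_tendsto_exp_cycleEigenvalue hk
  have hperiod : ∀ (t : ℕ) (c : ℤ), Complex.exp (Complex.I * (2 * Real.pi * t) * c) = 1 :=
    fun t c => Complex.exp_eq_one_iff.2 ⟨t * c, by push_cast; ring⟩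
  refine h.hasPGST (fun l => 2 * Real.pi * τ l) (fun j _ => ?_) (fun ε hε => ?_)
  · obtain ⟨J, rfl⟩ : ∃ J : ℕ, (J : ZMod (2 * 2 ^ k)) = j := ⟨j.val, ZMod.natCast_zmod_val j⟩
    obtain ⟨c, hc⟩ := hint (AddChar.mulShift ZMod.stdAddChar (J : ZMod (2 * 2 ^ k)))
    have hT := hsum (AddChar.mulShift ZMod.stdAddChar (J : ZMod (2 * 2 ^ k)))
    rw [hc] at hT
    simp only [AddChar.mulShift_apply] at hT
    rw [mul_neg, ← Nat.cast_mul, stdAddChar_add_neg] at hT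
    -- The character indexed by `J` sees the cosine of index `J * k₁`, whose parity is that of `J`.
    have hlim := hτ (J * k₁)
    rw [pow_mul', hk₁.neg_one_pow] at hlim
    rw [stdAddChar_neg_natCast_mul]
    refine hlim.congr fun l => ?_
    rw [hT, mul_add, Complex.exp_add]
    push_cast
    rw [hperiod, mul_one]
    congr 1
    ring
  · obtain ⟨c, hc⟩ : ∃ c : ℤ, (T.card : ℂ) + ε * (2 * 2 ^ k : ℕ) = c := by
      rcases hε with rfl | rfl
      · exact ⟨T.card + (2 * 2 ^ k : ℕ), by push_cast; ring⟩
      · exact ⟨T.card - (2 * 2 ^ k : ℕ), by push_cast; ring⟩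
    refine tendsto_const_nhds.congr fun l => ?_
    rw [hc]
    push_cast
    rw [hperiod]

/-- The Cayley graphs `Cay(T_{4n}, S₁ ∪ ⟨a⟩b)`, with `S₁` a pair of odd powers of `a` together with
the powers of `a` whose exponents have prescribed positive `2`-adic valuations. -/
theorem hasPGST_cayleyGraph {k : ℕ} (hk : 2 ≤ k) {k₁ : ℕ} (hk₁ : Odd k₁) (M : Finset ℕ)
    (hM : ∀ m ∈ M, 1 ≤ m ∧ m ≤ k) :
    HasPGST (cayleyGraph (({genA (2 ^ k) ^ k₁, (genA (2 ^ k) ^ k₁)⁻¹} ∪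
      ⋃ m ∈ M, {g | ∃ z : ℕ, Nat.gcd z 2 = 1 ∧ 1 ≤ z ∧ z ≤ 2 ^ (k - m + 1) - 1 ∧
        g = genA (2 ^ k) ^ (2 ^ m * z)}) ∪ cosetB (2 ^ k))) (a 0) (a (2 ^ k : ℕ)) := by
  let U : Finset (ZMod (2 * 2 ^ k)) := M.biUnion (dyadicLevel (2 * 2 ^ k))
  let P : Finset (ZMod (2 * 2 ^ k)) := {(k₁ : ZMod (2 * 2 ^ k)), -(k₁ : ZMod (2 * 2 ^ k))}
  have heven : ∀ s ∈ U, ((2 : ℕ) : ZMod (2 * 2 ^ k)) ∣ s ∧ s ≠ 0 := by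
    intro s hs
    obtain ⟨m, hm, hs⟩ := Finset.mem_biUnion.1 hs
    rw [mem_dyadicLevel] at hs
    refine ⟨(Nat.cast_dvd_cast (dvd_pow_self 2 (by have := hM m hm; omega))).trans hs.1, ?_⟩
    rintro rfl
    exact hs.2 (dvd_zero _)
  have hk₁_odd : ¬ ((2 : ℕ) : ZMod (2 * 2 ^ k)) ∣ (k₁ : ZMod (2 * 2 ^ k)) := by
    rw [zmod_natCast_dvd_natCast_iff (dvd_mul_right 2 _)]
    exact hk₁.not_two_dvd_nat
  have hdisj : Disjoint P U := by
    rw [Finset.disjoint_left]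
    intro s hs hsU
    have h2 := (heven s hsU).1
    simp only [P, Finset.mem_insert, Finset.mem_singleton] at hs
    rcases hs with rfl | rfl
    · exact hk₁_odd h2
    · exact hk₁_odd (by simpa using h2)
  -- Equality would make `2 ^ k` divide `k₁`, which is odd.
  have hne : (k₁ : ZMod (2 * 2 ^ k)) ≠ -k₁ := by
    intro h
    rw [eq_neg_iff_add_eq_zero, ← Nat.cast_add, ZMod.natCast_eq_zero_iff, ← two_mul,
      Nat.mul_dvd_mul_iff_left two_pos] at h
    exact hk₁.not_two_dvd_nat ((dvd_pow_self 2 (by omega)).trans h)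
  have hjoin := isCirculantJoin_cayleyGraph (T := P ∪ U) (n := 2 ^ k)
    (S := ({genA (2 ^ k) ^ k₁, (genA (2 ^ k) ^ k₁)⁻¹} ∪
      ⋃ m ∈ M, {g | ∃ z : ℕ, Nat.gcd z 2 = 1 ∧ 1 ≤ z ∧ z ≤ 2 ^ (k - m + 1) - 1 ∧
        g = genA (2 ^ k) ^ (2 ^ m * z)}) ∪ cosetB (2 ^ k)) ?_ ?_ ?_
  · refine hjoin.exists_hasPGST hk (U := U) hk₁ (fun ψ => ?_) (fun ψ => ?_)
    · rw [Finset.sum_union hdisj, Finset.sum_pair hne]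
    · choose c hc using fun m => exists_int_eq_sum_dyadicLevel (N := 2 * 2 ^ k) m ψ
      refine ⟨∑ m ∈ M, c m, ?_⟩
      rw [Finset.sum_biUnion fun m _ m' _ hmm => disjoint_dyadicLevel hmm]
      simp [hc]
  · rw [cosetB_eq]
    congr 1
    ext g
    simp only [genA, a_one_pow, Set.mem_union, Set.mem_insert_iff, Set.mem_singleton_iff,
      Set.mem_iUnion, Set.mem_ofPred_eq, exists_prop, Finset.mem_union, P, U, Finset.mem_insert,
      Finset.mem_singleton, Finset.mem_biUnion]
    constructor
    · rintro ((rfl | rfl) | ⟨m, hm, z, h1, h2, h3, rfl⟩)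
      · exact ⟨_, Or.inl (Or.inl rfl), rfl⟩
      · exact ⟨_, Or.inl (Or.inr rfl), rfl⟩
      · exact ⟨_, Or.inr ⟨m, hm,
          (mem_dyadicLevel_two_pow_iff (hM m hm).2).2 ⟨z, h1, h2, h3, rfl⟩⟩, rfl⟩
    · rintro ⟨s, ((rfl | rfl) | ⟨m, hm, hs⟩), rfl⟩
      · exact Or.inl (Or.inl rfl)
      · exact Or.inl (Or.inr rfl)
      · obtain ⟨z, h1, h2, h3, rfl⟩ := (mem_dyadicLevel_two_pow_iff (hM m hm).2).1 hs
        exact Or.inr ⟨m, hm, z, h1, h2, h3, rfl⟩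
  · simp only [P, Finset.mem_union, Finset.mem_insert, Finset.mem_singleton, not_or]
    refine ⟨⟨fun h => hk₁_odd (h ▸ dvd_zero _), fun h => hk₁_odd ?_⟩, fun h => (heven 0 h).2 rfl⟩
    rw [zero_eq_neg.1 h]
    exact dvd_zero _
  · intro s hs
    rcases Finset.mem_union.1 hs with hs | hs
    · refine Finset.mem_union_left _ ?_
      simp only [P, Finset.mem_insert, Finset.mem_singleton] at hs ⊢
      rcases hs with rfl | rfl <;> simp
    · obtain ⟨m, hm, hs⟩ := Finset.mem_biUnion.1 hs
      exact Finset.mem_union_right _ (Finset.mem_biUnion.2 ⟨m, hm, neg_mem_dyadicLevel hs⟩)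

end Transfer

end QuantumWalk

theorem mainTheorem3 (k : ℕ) (hk : 2 ≤ k)
    (S S₁ : Set (QuaternionGroup (2 ^ k)))
    (hS : S = S₁ ∪ QuantumWalk.cosetB (2 ^ k))
    (k₁ : ℕ) (hk₁_odd : Odd k₁) (hk₁_one : 1 ≤ k₁) (hk₁_le : k₁ ≤ 2 ^ k - 1)
    (hS₁ :
      S₁ = {QuantumWalk.genA (2 ^ k) ^ k₁, (QuantumWalk.genA (2 ^ k) ^ k₁)⁻¹} ∨
      ∃ (r : ℕ) (m : Fin r → ℕ), StrictMono m ∧ (∀ j, 1 ≤ m j ∧ m j ≤ k) ∧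
        S₁ = {QuantumWalk.genA (2 ^ k) ^ k₁, (QuantumWalk.genA (2 ^ k) ^ k₁)⁻¹} ∪
          ⋃ j : Fin r, {g | ∃ z : ℕ, Nat.gcd z 2 = 1 ∧ 1 ≤ z ∧ z ≤ 2 ^ (k - m j + 1) - 1 ∧
            g = QuantumWalk.genA (2 ^ k) ^ (2 ^ m j * z)}) :
    QuantumWalk.AdmitsPGST (QuantumWalk.cayleyGraph S) ∧
      QuantumWalk.AdmitsPGFR (QuantumWalk.cayleyGraph S) := by
  -- The first case is the second with no dyadic levels, so `M = ∅` there.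
  obtain ⟨M, hM, hSM⟩ : ∃ M : Finset ℕ, (∀ m ∈ M, 1 ≤ m ∧ m ≤ k) ∧
      S₁ = {QuantumWalk.genA (2 ^ k) ^ k₁, (QuantumWalk.genA (2 ^ k) ^ k₁)⁻¹} ∪
        ⋃ m ∈ M, {g | ∃ z : ℕ, Nat.gcd z 2 = 1 ∧ 1 ≤ z ∧ z ≤ 2 ^ (k - m + 1) - 1 ∧
          g = QuantumWalk.genA (2 ^ k) ^ (2 ^ m * z)} := by
    rcases hS₁ with h | ⟨r, m, -, hm, h⟩
    · exact ⟨∅, by simp, by simp [h]⟩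
    · exact ⟨Finset.univ.image m, by simpa using hm, by simp [h]⟩
  subst hS hSM
  have hne : (QuaternionGroup.a 0 : QuaternionGroup (2 ^ k)) ≠ QuaternionGroup.a (2 ^ k : ℕ) := by
    rw [Ne, QuaternionGroup.a.injEq, eq_comm, ZMod.natCast_eq_zero_iff]
    exact Nat.not_dvd_of_pos_of_lt (by positivity) (by have := Nat.two_pow_pos k; omega)
  have h := QuantumWalk.hasPGST_cayleyGraph hk hk₁_odd M hM
  exact ⟨⟨_, _, hne, h⟩, ⟨_, _, hne, h.hasPGFR⟩⟩
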